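/- Let $\mathcal D^{\rm LSL}$ be the set of all functions $\delta:[0,1]\to[0,1]$ that are non-decreasing and $2$-Lipschitz with $\delta(1)=1$ and $\delta(t)\le t$ for all $t\in[0,1]$, and for which $t\mapsto \delta(t)/t$ is non-decreasing and $t\mapsto\delta(t)/t^2$ is non-increasing on $(0,1]$. For $\delta\in\mathcal D^{\rm LSL}$ let $S_\delta:[0,1]^2\to[0,1]$ be the lower semilinear copula $$S_\delta(u,v)=\begin{cases} v\,\delta(u)/u & \text{if } v\le u,\\ u\,\delta(v)/v & \text{otherwise,}\end{cases}\qquad S_\delta(0,0)=0.$$ Write $\phi(S_\delta)=6\int_0^1 S_\delta(t,t)\,dt-2=6\int_0^1\delta(t)\,dt-2$ for Spearman's footrule, and $$\xi(S_\delta)=\frac{\int_{\mathbb R}\operatorname{Var}\big(P(Y\ge y\mid X)\big)\,dP^Y(y)}{\int_{\mathbb R}\operatorname{Var}\big(\mathbf 1_{\{Y\ge y\}}\big)\,dP^Y(y)}$$ for Chatterjee's rank correlation, where $X,Y$ are any real random variables with continuous distribution functions $F_X,F_Y$ and joint distribution function $(x,y)\mapsto S_\delta(F_X(x),F_Y(y))$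 (such random variables exist for every $\delta\in\mathcal D^{\rm LSL}$). Then, for every $\delta\in\mathcal D^{\rm LSL}$ and every such pair $X,Y$, $$\xi(S_\delta)\le\phi(S_\delta).$$ The inequality is sharp: for every $s\in[0,1]$ there is $\delta\in\mathcal D^{\rm LSL}$ with $\phi(S_\delta)=s$ and, for every such pair $X,Y$, $\xi(S_\delta)=s$. -/

import Mathlib

open MeasureTheory ProbabilityTheory Set

/-- The class of diagonals of lower semilinear copulas. A function `δ : [0,1] → [0,1]` is modelled
by a function `ℝ → ℝ` of which only the values on `[0,1]` matter. The first five fields say that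
`δ` is a copula diagonal; the last two are the shape constraints, imposed where the quotients are
defined. -/
structure IsLSLDiagonal (δ : ℝ → ℝ) : Prop where
  nonneg : ∀ t ∈ Icc (0 : ℝ) 1, 0 ≤ δ t
  le_self : ∀ t ∈ Icc (0 : ℝ) 1, δ t ≤ t
  map_one : δ 1 = 1
  monotoneOn : MonotoneOn δ (Icc 0 1)
  lipschitzOnWith : LipschitzOnWith 2 δ (Icc 0 1)
  monotoneOn_div : MonotoneOn (fun t => δ t / t) (Ioc 0 1)
  antitoneOn_div_sq : AntitoneOn (fun t => δ t / t ^ 2) (Ioc 0 1)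

/-- The lower semilinear copula `S_δ`, relevant on `[0,1]²`. At `u = v = 0` the first branch
gives the value `0`. -/
noncomputable def lowerSemilinear (δ : ℝ → ℝ) (u v : ℝ) : ℝ :=
  if v ≤ u then v * (δ u / u) else u * (δ v / v)

/-- `X` and `Y` are real random variables with continuous distribution functions `F_X`, `F_Y` whose
joint distribution function is `(x, y) ↦ C (F_X x) (F_Y y)`. -/
structure HasCopula {Ω : Type*} [MeasurableSpace Ω] (P : Measure Ω) (X Y : Ω → ℝ)
    (C : ℝ → ℝ → ℝ) : Prop where
  measurable_fst : Measurable X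
  measurable_snd : Measurable Y
  continuous_fst : Continuous fun x : ℝ => P.real {ω | X ω ≤ x}
  continuous_snd : Continuous fun y : ℝ => P.real {ω | Y ω ≤ y}
  joint : ∀ x y : ℝ, P.real {ω | X ω ≤ x ∧ Y ω ≤ y} =
    C (P.real {ω | X ω ≤ x}) (P.real {ω | Y ω ≤ y})

/-- Chatterjee's rank correlation of `Y` given `X`:
`∫ Var(P(Y ≥ y | X)) dP^Y(y) / ∫ Var(1_{Y ≥ y}) dP^Y(y)`. -/
noncomputable def chatterjeeXi {Ω : Type*} [MeasurableSpace Ω] (P : Measure Ω)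
    (X Y : Ω → ℝ) : ℝ :=
  (∫ y, variance
      (P[({ω | y ≤ Y ω}).indicator (fun _ => (1 : ℝ)) | MeasurableSpace.comap X inferInstance]) P
      ∂(P.map Y)) /
    ∫ y, variance (({ω | y ≤ Y ω}).indicator (fun _ => (1 : ℝ))) P ∂(P.map Y)

/-- Spearman's footrule of a copula `C`. -/
noncomputable def spearmanFootrule (C : ℝ → ℝ → ℝ) : ℝ :=
  6 * (∫ t in Icc (0 : ℝ) 1, C t t) - 2

/-! Write `g u = δ u / u` and `γ = g'`, so that `δ' = g + u γ` almost everywhere. The shape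
constraints say exactly that `0 ≤ γ` and `u γ ≤ g`, and `δ t ≤ t` gives `g ≤ 1`.

The partial derivative `∂₁ S_δ (u, v)` is `v γ(u)` for `v < u` and `g(v)` for `u < v`. It is the
conditional probability of `Y ≤ y` given `X` in uniform coordinates, so `ξ = 6 ∫∫ (∂₁ S_δ)² - 2`
(`HasCopula.chatterjeeXi_eq`), and Fubini turns the double integral into `∫ (u³γ²/3 + u g²)`.

Hence `(φ - ξ)/6 = ∫ (u g - u g² - u³γ²/3)`. This integrand has no evident sign, but `δ (u - δ)`
vanishes at `0` and `1`, so a third of its derivative may be subtracted. What remains factors as `(g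
- uγ)(u(1 - g) + u²γ)/3`, a product of nonnegative terms
(`integral_sub_integral_integral_lslKernel_sq`).

Equality holds if almost everywhere `u γ = g` (`δ` is a multiple of `t²`) or `g = 1`, `γ = 0` (`δ t
= t`). Gluing `t²/c` on `[0,c]` to `t` on `[c,1]` gives footrule `1 - c²`, which covers `[0,1]`.

A law with copula `S_δ` has density `γ(max x y)` off the diagonal and mass `(g - uγ) du` on it. -/

/-! ### Calculus of absolutely continuous functions -/

theorem AbsolutelyContinuousOnInterval.intervalIntegrable_and_integral_eq_sub
    {f f' : ℝ → ℝ} {a b : ℝ} (hf : AbsolutelyContinuousOnInterval f a b)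
    (h : ∀ᵐ x, x ∈ uIoc a b → HasDerivAt f (f' x) x) :
    IntervalIntegrable f' volume a b ∧ ∫ x in a..b, f' x = f b - f a := by
  have h' : ∀ᵐ x, x ∈ uIoc a b → deriv f x = f' x := by
    filter_upwards [h] with x hx hxm using (hx hxm).deriv
  refine ⟨hf.intervalIntegrable_deriv.congr_ae ?_, ?_⟩
  · exact (ae_restrict_iff' measurableSet_uIoc).2 h'
  · rw [← hf.integral_deriv_eq_sub]
    exact (intervalIntegral.integral_congr_ae h').symm

theorem absolutelyContinuousOnInterval_inv {a b : ℝ} (ha : 0 < a) (hab : a ≤ b) :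
    AbsolutelyContinuousOnInterval (fun x : ℝ => x⁻¹) a b := by
  refine LipschitzOnWith.absolutelyContinuousOnInterval
    (K := .mk (a ^ 2)⁻¹ (by positivity)) (LipschitzOnWith.of_dist_le_mul fun x hx y hy => ?_)
  rw [uIcc_of_le hab] at hx hy
  have hx0 : 0 < x := ha.trans_le hx.1
  have hy0 : 0 < y := ha.trans_le hy.1
  rw [Real.dist_eq, Real.dist_eq, NNReal.coe_mk, inv_sub_inv hx0.ne' hy0.ne', abs_div,
    abs_of_pos (mul_pos hx0 hy0), abs_sub_comm y x, div_eq_inv_mul]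
  gcongr
  nlinarith [hx.1, hy.1]

theorem nonneg_of_monotoneOn_of_hasDerivAt {f : ℝ → ℝ} {s : Set ℝ} {x d : ℝ}
    (hf : MonotoneOn f s) (hs : s ∈ nhds x) (h : HasDerivAt f d x) : 0 ≤ d := by
  obtain ⟨t, hts, hto, hxt⟩ := mem_nhds_iff.1 hs
  have := (hf.mono hts).derivWithin_nonneg (x := x)
  rwa [derivWithin_of_isOpen hto hxt, h.deriv] at this

/-! ### Diagonals and lower semilinear copulas -/

namespace IsLSLDiagonal

variable {δ ε : ℝ → ℝ}

theorem map_zero (h : IsLSLDiagonal δ) : δ 0 = 0 :=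
  le_antisymm (h.le_self 0 (by simp)) (h.nonneg 0 (by simp))

theorem congr (h : IsLSLDiagonal δ) (he : EqOn δ ε (Icc 0 1)) : IsLSLDiagonal ε where
  nonneg t ht := he ht ▸ h.nonneg t ht
  le_self t ht := he ht ▸ h.le_self t ht
  map_one := (he (by simp : (1 : ℝ) ∈ Icc (0 : ℝ) 1)) ▸ h.map_one
  monotoneOn := h.monotoneOn.congr he
  lipschitzOnWith := fun x hx y hy => he hx ▸ he hy ▸ h.lipschitzOnWith hx hy
  monotoneOn_div := h.monotoneOn_div.congr fun t ht => by
    simp only [he (Ioc_subset_Icc_self ht)]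
  antitoneOn_div_sq := h.antitoneOn_div_sq.congr fun t ht => by
    simp only [he (Ioc_subset_Icc_self ht)]

/-- A global extension makes `δ` continuous, measurable and almost everywhere differentiable on `ℝ`;
nothing is lost, since only values on `[0,1]` enter the copula. -/
theorem exists_lipschitzWith (h : IsLSLDiagonal δ) :
    ∃ ε, LipschitzWith 2 ε ∧ EqOn δ ε (Icc 0 1) ∧ IsLSLDiagonal ε := by
  obtain ⟨ε, hε, he⟩ := h.lipschitzOnWith.extend_real
  exact ⟨ε, hε, he, h.congr he⟩

theorem div_nonneg (h : IsLSLDiagonal δ) {u : ℝ} (hu : u ∈ Icc (0 : ℝ) 1) : 0 ≤ δ u / u :=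
  _root_.div_nonneg (h.nonneg u hu) hu.1

theorem div_le_one (h : IsLSLDiagonal δ) {u : ℝ} (hu : u ∈ Icc (0 : ℝ) 1) : δ u / u ≤ 1 :=
  div_le_one_of_le₀ (h.le_self u hu) hu.1

theorem mul_div_self (h : IsLSLDiagonal δ) (u : ℝ) : u * (δ u / u) = δ u := by
  rcases eq_or_ne u 0 with rfl | hu
  · simp [h.map_zero]
  · field_simp

end IsLSLDiagonal

theorem lowerSemilinear_congr {δ ε : ℝ → ℝ} (he : EqOn δ ε (Icc 0 1)) {u v : ℝ}
    (hu : u ∈ Icc (0 : ℝ) 1) (hv : v ∈ Icc (0 : ℝ) 1) :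
    lowerSemilinear δ u v = lowerSemilinear ε u v := by
  simp only [lowerSemilinear, he hu, he hv]

theorem lowerSemilinear_self {δ : ℝ → ℝ} (h : IsLSLDiagonal δ) (u : ℝ) :
    lowerSemilinear δ u u = δ u := by
  rw [lowerSemilinear, if_pos le_rfl, h.mul_div_self]

theorem spearmanFootrule_lowerSemilinear {δ : ℝ → ℝ} (h : IsLSLDiagonal δ) :
    spearmanFootrule (lowerSemilinear δ) = 6 * (∫ t in (0 : ℝ)..1, δ t) - 2 := by
  rw [spearmanFootrule, intervalIntegral.integral_of_le zero_le_one, integral_Icc_eq_integral_Ioc]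
  simp_rw [lowerSemilinear_self h]

/-! ### The slope of `δ u / u` -/

/-- The derivative of `u ↦ δ u / u`, clipped so that its a priori bounds hold everywhere. -/
noncomputable def lslSlope (δ : ℝ → ℝ) (u : ℝ) : ℝ :=
  if u ∈ Ioc (0 : ℝ) 1 then max 0 (min ((deriv δ u - δ u / u) / u) (δ u / u / u)) else 0

theorem measurable_lslSlope {δ : ℝ → ℝ} (hδ : Measurable δ) : Measurable (lslSlope δ) := by
  refine Measurable.ite measurableSet_Ioc ?_ measurable_const
  have := measurable_deriv δ
  fun_prop

theorem lslSlope_nonneg (δ : ℝ → ℝ) (u : ℝ) : 0 ≤ lslSlope δ u := by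
  unfold lslSlope
  split_ifs <;> simp

namespace IsLSLDiagonal

variable {δ : ℝ → ℝ}

theorem mul_lslSlope_le (h : IsLSLDiagonal δ) {u : ℝ} (hu : u ∈ Icc (0 : ℝ) 1) :
    u * lslSlope δ u ≤ δ u / u := by
  unfold lslSlope
  split_ifs with hu'
  · have h1 : max 0 (min ((deriv δ u - δ u / u) / u) (δ u / u / u)) ≤ δ u / u / u :=
      max_le (_root_.div_nonneg (h.div_nonneg hu) hu.1) (min_le_right _ _)
    calc _ ≤ u * (δ u / u / u) := mul_le_mul_of_nonneg_left h1 hu.1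
      _ = _ := by have := hu'.1.ne'; field_simp
  · rw [mul_zero]
    exact h.div_nonneg hu

theorem hasDerivAt_div_of_hasDerivAt {u d : ℝ} (hu : u ≠ 0) (hd : HasDerivAt δ d u) :
    HasDerivAt (fun t => δ t / t) ((d - δ u / u) / u) u := by
  convert! hd.fun_div (hasDerivAt_id' u) hu using 1
  field_simp

/-- The clipping is inactive at points of differentiability: monotonicity of `δ t / t` gives the
lower bound, and the sign of the derivative of `δ t / t ^ 2` gives the upper one. -/
theorem lslSlope_eq (h : IsLSLDiagonal δ) {u : ℝ} (hu : u ∈ Ioo (0 : ℝ) 1)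
    (hd : DifferentiableAt ℝ δ u) : lslSlope δ u = (deriv δ u - δ u / u) / u := by
  have hu0 := hu.1.ne'
  have hs : Ioc (0 : ℝ) 1 ∈ nhds u := Ioc_mem_nhds hu.1 hu.2
  have h1 := nonneg_of_monotoneOn_of_hasDerivAt h.monotoneOn_div hs
    (hasDerivAt_div_of_hasDerivAt hu0 hd.hasDerivAt)
  have h2 := nonneg_of_monotoneOn_of_hasDerivAt h.antitoneOn_div_sq.neg hs
    ((hd.hasDerivAt.fun_div (hasDerivAt_pow 2 u) (by positivity)).neg)
  have h3 : (deriv δ u - δ u / u) / u ≤ δ u / u / u := by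
    have h4 : δ u / u / u - (deriv δ u - δ u / u) / u =
        u * -((deriv δ u * u ^ 2 - δ u * ((2 : ℕ) * u ^ (2 - 1))) / (u ^ 2) ^ 2) := by
      field_simp
      push_cast
      ring
    rw [← sub_nonneg, h4]
    exact mul_nonneg hu.1.le h2
  rw [lslSlope, if_pos ⟨hu.1, hu.2.le⟩, min_eq_left h3, max_eq_right h1]

theorem ae_hasDerivAt (h : IsLSLDiagonal δ) (hL : LipschitzWith 2 δ) :
    ∀ᵐ u : ℝ, u ∈ Ioc (0 : ℝ) 1 → HasDerivAt δ (δ u / u + u * lslSlope δ u) u ∧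
      HasDerivAt (fun t => δ t / t) (lslSlope δ u) u := by
  -- At `1` the shape constraints control only one side, so this null point is dropped.
  have h1 : ∀ᵐ u : ℝ, u ≠ 1 := by simp [ae_iff]
  filter_upwards [hL.ae_differentiableAt_real, h1] with u hd hu1 hu
  have hu' : u ∈ Ioo (0 : ℝ) 1 := ⟨hu.1, lt_of_le_of_ne hu.2 hu1⟩
  have hu0 := hu.1.ne'
  rw [h.lslSlope_eq hu' hd]
  refine ⟨?_, hasDerivAt_div_of_hasDerivAt hu0 hd.hasDerivAt⟩
  convert! hd.hasDerivAt using 1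
  field_simp
  ring

/-- Away from `0` the quotient is a product of Lipschitz functions, hence absolutely continuous;
this is why `a` is positive. -/
theorem integral_lslSlope (h : IsLSLDiagonal δ) (hL : LipschitzWith 2 δ) {a b : ℝ}
    (ha : 0 < a) (hab : a ≤ b) (hb : b ≤ 1) :
    IntervalIntegrable (lslSlope δ) volume a b ∧
      ∫ u in a..b, lslSlope δ u = δ b / b - δ a / a := by
  have hac : AbsolutelyContinuousOnInterval (fun t => δ t / t) a b :=
    (hL.lipschitzOnWith.absolutelyContinuousOnInterval).fun_mul
      (absolutelyContinuousOnInterval_inv ha hab)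
  refine hac.intervalIntegrable_and_integral_eq_sub ?_
  filter_upwards [h.ae_hasDerivAt hL] with u hu hum
  rw [uIoc_of_le hab] at hum
  exact (hu ⟨ha.trans hum.1, hum.2.trans hb⟩).2

theorem integral_deriv (h : IsLSLDiagonal δ) (hL : LipschitzWith 2 δ) {b : ℝ}
    (hb : b ∈ Icc (0 : ℝ) 1) :
    IntervalIntegrable (fun u => δ u / u + u * lslSlope δ u) volume 0 b ∧
      ∫ u in (0 : ℝ)..b, (δ u / u + u * lslSlope δ u) = δ b := by
  have := (hL.lipschitzOnWith (s := uIcc 0 b)).absolutelyContinuousOnInterval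
    |>.intervalIntegrable_and_integral_eq_sub (f' := fun u => δ u / u + u * lslSlope δ u) (by
      filter_upwards [h.ae_hasDerivAt hL] with u hu hum
      rw [uIoc_of_le hb.1] at hum
      exact (hu ⟨hum.1, hum.2.trans hb.2⟩).1)
  rwa [h.map_zero, sub_zero] at this

end IsLSLDiagonal

/-! ### The kernel `∂₁ S_δ` -/

/-- A version of the partial derivative `u ↦ ∂₁ S_δ (u, v)`. -/
noncomputable def lslKernel (δ : ℝ → ℝ) (v u : ℝ) : ℝ :=
  if v < u then v * lslSlope δ u else δ v / v

theorem measurable_lslKernel {δ : ℝ → ℝ} (hδ : Measurable δ) :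
    Measurable (Function.uncurry (lslKernel δ)) := by
  have := measurable_lslSlope hδ
  refine Measurable.ite (measurableSet_lt measurable_fst measurable_snd) ?_ ?_ <;> fun_prop

namespace IsLSLDiagonal

variable {δ : ℝ → ℝ}

theorem lslKernel_mem_Icc (h : IsLSLDiagonal δ) {v : ℝ} (hv : v ∈ Icc (0 : ℝ) 1) (u : ℝ) :
    lslKernel δ v u ∈ Icc (0 : ℝ) 1 := by
  unfold lslKernel
  split_ifs with hvu
  · refine ⟨mul_nonneg hv.1 (lslSlope_nonneg δ u), ?_⟩
    by_cases hu : u ∈ Ioc (0 : ℝ) 1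
    · have hu' := Ioc_subset_Icc_self hu
      exact (mul_le_mul_of_nonneg_right hvu.le (lslSlope_nonneg δ u)).trans
        ((h.mul_lslSlope_le hu').trans (h.div_le_one hu'))
    · simp [lslSlope, hu]
  · exact ⟨h.div_nonneg hv, h.div_le_one hv⟩

theorem integral_lslKernel (h : IsLSLDiagonal δ) (hL : LipschitzWith 2 δ) {t v : ℝ}
    (ht : t ∈ Icc (0 : ℝ) 1) (hv : v ∈ Icc (0 : ℝ) 1) :
    ∫ u in (0 : ℝ)..t, lslKernel δ v u = lowerSemilinear δ t v := by
  have hle {s : ℝ} (hs0 : 0 ≤ s) (hs : s ≤ v) :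
      IntervalIntegrable (lslKernel δ v) volume 0 s ∧
        ∫ u in (0 : ℝ)..s, lslKernel δ v u = s * (δ v / v) := by
    have he : ∀ u ∈ uIoc 0 s, δ v / v = lslKernel δ v u := fun u hu => by
      rw [uIoc_of_le hs0] at hu
      rw [lslKernel, if_neg (hu.2.trans hs).not_gt]
    refine ⟨(intervalIntegrable_const (c := δ v / v)).congr he, ?_⟩
    rw [← intervalIntegral.integral_congr_ae (.of_forall he)]
    simp [mul_div_assoc]
  rcases le_or_gt t v with htv | htv
  · rw [(hle ht.1 htv).2, lowerSemilinear]
    split_ifs with hvt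
    · rw [le_antisymm htv hvt]
    · rfl
  · have he : ∀ u ∈ uIoc v t, v * lslSlope δ u = lslKernel δ v u := fun u hu => by
      rw [uIoc_of_le htv.le] at hu
      rw [lslKernel, if_pos hu.1]
    rw [lowerSemilinear, if_pos htv.le]
    -- `integral_lslSlope` needs a positive left endpoint; at `v = 0` the factor `v` kills the
    -- integrand.
    rcases hv.1.eq_or_lt with rfl | hv0
    · rw [← intervalIntegral.integral_congr_ae (.of_forall he)]
      simp
    · have hs := h.integral_lslSlope hL hv0 htv.le ht.2
      rw [← intervalIntegral.integral_add_adjacent_intervals (hle hv.1 le_rfl).1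
        ((hs.1.const_mul v).congr he), (hle hv.1 le_rfl).2,
        ← intervalIntegral.integral_congr_ae (.of_forall he),
        intervalIntegral.integral_const_mul, hs.2]
      ring

end IsLSLDiagonal

theorem intervalIntegrable_of_forall_abs_le_one {f : ℝ → ℝ} (hf : Measurable f)
    (hb : ∀ u ∈ Icc (0 : ℝ) 1, |f u| ≤ 1) : IntervalIntegrable f volume 0 1 := by
  rw [intervalIntegrable_iff_integrableOn_Ioc_of_le zero_le_one]
  exact Integrable.of_bound hf.aestronglyMeasurable 1
    (ae_restrict_of_forall_mem measurableSet_Ioc fun u hu => hb u (Ioc_subset_Icc_self hu))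

/-! ### The energy of the kernel and the gap formula -/

namespace IsLSLDiagonal

variable {δ : ℝ → ℝ}

/-- Split the square along the diagonal. On `v < u`, Fubini integrates `v ^ 2` over `(0, u)` first,
giving `u ^ 3 / 3`; on `u ≤ v` the kernel does not depend on `u`, giving a factor `v`. -/
theorem integral_integral_lslKernel_sq (h : IsLSLDiagonal δ) (hδ : Measurable δ) :
    ∫ v in (0 : ℝ)..1, ∫ u in (0 : ℝ)..1, lslKernel δ v u ^ 2 =
      ∫ u in (0 : ℝ)..1, (u ^ 3 * lslSlope δ u ^ 2 / 3 + u * (δ u / u) ^ 2) := by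
  have hγ := measurable_lslSlope hδ
  set A : ℝ → ℝ → ℝ := fun v u => if v < u then (v * lslSlope δ u) ^ 2 else 0 with hA
  have hAm : Measurable (Function.uncurry A) :=
    Measurable.ite (measurableSet_lt measurable_fst measurable_snd) (by fun_prop) measurable_const
  have hAb : ∀ v ∈ Icc (0 : ℝ) 1, ∀ u, |A v u| ≤ 1 := fun v hv u => by
    have hk := h.lslKernel_mem_Icc hv u
    simp only [hA]
    split_ifs with hvu
    · rw [lslKernel, if_pos hvu] at hk
      rw [abs_of_nonneg (sq_nonneg _)]
      exact pow_le_one₀ hk.1 hk.2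
    · simp
  have hAint : Integrable (Function.uncurry A)
      ((volume.restrict (Ioc (0 : ℝ) 1)).prod (volume.restrict (Ioc (0 : ℝ) 1))) := by
    refine Integrable.of_bound hAm.aestronglyMeasurable 1 ?_
    rw [Measure.prod_restrict]
    exact ae_restrict_of_forall_mem (measurableSet_Ioc.prod measurableSet_Ioc)
      fun p hp => hAb p.1 (Ioc_subset_Icc_self hp.1) p.2
  have hswap : ∫ v in (0 : ℝ)..1, ∫ u in (0 : ℝ)..1, A v u =
      ∫ u in (0 : ℝ)..1, ∫ v in (0 : ℝ)..1, A v u := by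
    simp only [intervalIntegral.integral_of_le zero_le_one]
    exact integral_integral_swap hAint
  have hinner : ∀ u ∈ Icc (0 : ℝ) 1,
      ∫ v in (0 : ℝ)..1, A v u = u ^ 3 * lslSlope δ u ^ 2 / 3 := fun u hu => by
    have he : (fun v => A v u) = (Iio u).indicator fun v => (v * lslSlope δ u) ^ 2 := by
      ext v
      simp [hA, indicator]
    have hs : Ioc (0 : ℝ) 1 ∩ Iio u = Ioo 0 u := by
      ext v
      exact ⟨fun hv => ⟨hv.1.1, hv.2⟩, fun hv => ⟨⟨hv.1, hv.2.le.trans hu.2⟩, hv.2⟩⟩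
    rw [intervalIntegral.integral_of_le zero_le_one, he, setIntegral_indicator measurableSet_Iio,
      hs, ← integral_Ioc_eq_integral_Ioo, ← intervalIntegral.integral_of_le hu.1]
    simp_rw [mul_pow]
    rw [intervalIntegral.integral_mul_const, integral_pow]
    norm_num
    ring
  have houter : ∀ v ∈ Icc (0 : ℝ) 1, ∫ u in (0 : ℝ)..1, lslKernel δ v u ^ 2 =
      (∫ u in (0 : ℝ)..1, A v u) + v * (δ v / v) ^ 2 := fun v hv => by
    have he : (fun u => lslKernel δ v u ^ 2) =
        fun u => A v u + (Iic v).indicator (fun _ => (δ v / v) ^ 2) u := by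
      ext u
      by_cases hvu : v < u
      · simp [lslKernel, hA, hvu]
      · simp [lslKernel, hA, hvu, not_lt.1 hvu]
    have hs : Ioc (0 : ℝ) 1 ∩ Iic v = Ioc 0 v := by
      ext u
      exact ⟨fun hu => ⟨hu.1.1, hu.2⟩, fun hu => ⟨⟨hu.1, hu.2.trans hv.2⟩, hu.2⟩⟩
    rw [he, intervalIntegral.integral_add]
    · congr 1
      rw [intervalIntegral.integral_of_le zero_le_one, setIntegral_indicator measurableSet_Iic, hs,
        ← intervalIntegral.integral_of_le hv.1]
      simp
    · exact intervalIntegrable_of_forall_abs_le_one (hAm.comp measurable_prodMk_left)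
        fun u _ => hAb v hv u
    · refine intervalIntegrable_of_forall_abs_le_one
        (measurable_const.indicator measurableSet_Iic) fun u _ => ?_
      refine abs_le.2 ⟨?_, ?_⟩
      · exact le_trans (by norm_num) (indicator_nonneg (fun _ _ => sq_nonneg _) u)
      · exact indicator_apply_le' (fun _ => pow_le_one₀ (h.div_nonneg hv) (h.div_le_one hv))
          fun _ => zero_le_one
  have hI : (uIcc (0 : ℝ) 1) = Icc 0 1 := uIcc_of_le zero_le_one
  have hAi : IntervalIntegrable (fun v => ∫ u in (0 : ℝ)..1, A v u) volume 0 1 := by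
    rw [intervalIntegrable_iff_integrableOn_Ioc_of_le zero_le_one]
    simp only [intervalIntegral.integral_of_le zero_le_one]
    exact hAint.integral_prod_left
  have hAi' : IntervalIntegrable (fun u => u ^ 3 * lslSlope δ u ^ 2 / 3) volume 0 1 := by
    refine intervalIntegrable_of_forall_abs_le_one (by fun_prop) fun u hu => ?_
    rw [← hinner u hu]
    refine (intervalIntegral.norm_integral_le_of_norm_le_const (a := 0) (b := 1)
      (f := fun v => A v u) (C := 1) fun v hv => ?_).trans (by simp)
    rw [uIoc_of_le zero_le_one] at hv
    exact hAb v (Ioc_subset_Icc_self hv) u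
  have hBi : IntervalIntegrable (fun u => u * (δ u / u) ^ 2) volume 0 1 := by
    refine intervalIntegrable_of_forall_abs_le_one (by fun_prop) fun u hu => ?_
    rw [abs_of_nonneg (mul_nonneg hu.1 (sq_nonneg _))]
    exact mul_le_one₀ hu.2 (sq_nonneg _) (pow_le_one₀ (h.div_nonneg hu) (h.div_le_one hu))
  rw [intervalIntegral.integral_congr (fun v hv => houter v (hI ▸ hv)),
    intervalIntegral.integral_add hAi hBi, hswap,
    intervalIntegral.integral_congr (fun u hu => hinner u (hI ▸ hu)),
    ← intervalIntegral.integral_add hAi' hBi]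

/-- The gap between the footrule and Chatterjee's correlation, up to a factor `6`, as the integral
of a nonnegative function. -/
theorem integral_sub_integral_integral_lslKernel_sq (h : IsLSLDiagonal δ)
    (hL : LipschitzWith 2 δ) :
    (∫ u in (0 : ℝ)..1, δ u) - ∫ v in (0 : ℝ)..1, ∫ u in (0 : ℝ)..1, lslKernel δ v u ^ 2 =
      ∫ u in (0 : ℝ)..1, (δ u / u - u * lslSlope δ u) *
        (u * (1 - δ u / u) + u ^ 2 * lslSlope δ u) / 3 := by
  have hδ : Measurable δ := hL.continuous.measurable
  have hγ := measurable_lslSlope hδ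
  -- This function vanishes at both endpoints. A third of its derivative is the null term that makes
  -- the integrand factor.
  have hac : AbsolutelyContinuousOnInterval (fun u => δ u * (u - δ u)) 0 1 :=
    hL.lipschitzOnWith.absolutelyContinuousOnInterval.fun_mul
      ((LipschitzWith.id.lipschitzOnWith.absolutelyContinuousOnInterval).sub
        hL.lipschitzOnWith.absolutelyContinuousOnInterval)
  obtain ⟨hi, hint⟩ := hac.intervalIntegrable_and_integral_eq_sub
    (f' := fun u => (δ u / u + u * lslSlope δ u) * (u - δ u) +
      δ u * (1 - (δ u / u + u * lslSlope δ u))) (by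
      filter_upwards [h.ae_hasDerivAt hL] with u hu hum
      rw [uIoc_of_le zero_le_one] at hum
      have := (hu hum).1
      exact this.mul ((hasDerivAt_id' u).sub this))
  have hb : ∀ u ∈ Icc (0 : ℝ) 1, 0 ≤ u ^ 3 * lslSlope δ u ^ 2 / 3 + u * (δ u / u) ^ 2 ∧
      u ^ 3 * lslSlope δ u ^ 2 / 3 + u * (δ u / u) ^ 2 ≤ 2 := fun u hu => by
    have h0 := hu.1
    have h1 := h.div_nonneg hu
    have h2 := h.div_le_one hu
    have h3 := h.mul_lslSlope_le hu
    have h4 := lslSlope_nonneg δ u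
    have h5 : (u * lslSlope δ u) ^ 2 ≤ 1 := pow_le_one₀ (mul_nonneg h0 h4) (h3.trans h2)
    have h6 : (δ u / u) ^ 2 ≤ 1 := pow_le_one₀ h1 h2
    refine ⟨by positivity, ?_⟩
    have h7 : u * (u * lslSlope δ u) ^ 2 ≤ 1 := mul_le_one₀ hu.2 (sq_nonneg _) h5
    have h8 : u * (δ u / u) ^ 2 ≤ 1 := mul_le_one₀ hu.2 (sq_nonneg _) h6
    linarith
  have hsi : IntervalIntegrable
      (fun u => u ^ 3 * lslSlope δ u ^ 2 / 3 + u * (δ u / u) ^ 2) volume 0 1 := by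
    rw [intervalIntegrable_iff_integrableOn_Ioc_of_le zero_le_one]
    refine Integrable.of_bound (by fun_prop) 2
      (ae_restrict_of_forall_mem measurableSet_Ioc fun u hu => ?_)
    have := hb u (Ioc_subset_Icc_self hu)
    rw [Real.norm_of_nonneg this.1]
    exact this.2
  rw [h.integral_integral_lslKernel_sq hδ, ← intervalIntegral.integral_sub
    (hL.continuous.intervalIntegrable 0 1) hsi]
  have hz : ∫ u in (0 : ℝ)..1, ((δ u / u + u * lslSlope δ u) * (u - δ u) +
      δ u * (1 - (δ u / u + u * lslSlope δ u))) / 3 = 0 := by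
    rw [intervalIntegral.integral_div, hint, h.map_one, h.map_zero]
    norm_num
  have hs := intervalIntegral.integral_sub
    ((hL.continuous.intervalIntegrable 0 1).sub hsi) (hi.div_const 3)
  rw [hz, sub_zero] at hs
  rw [← hs]
  refine intervalIntegral.integral_congr fun u _ => ?_
  have := h.mul_div_self u
  -- With `δ u = u * g` substituted, a polynomial identity in `u`, `g` and the slope remains.
  generalize δ u / u = g at *
  simp only [← this]
  ring

theorem integral_integral_lslKernel_sq_le (h : IsLSLDiagonal δ) (hL : LipschitzWith 2 δ) :
    ∫ v in (0 : ℝ)..1, ∫ u in (0 : ℝ)..1, lslKernel δ v u ^ 2 ≤ ∫ u in (0 : ℝ)..1, δ u := by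
  rw [← sub_nonneg, h.integral_sub_integral_integral_lslKernel_sq hL]
  refine intervalIntegral.integral_nonneg zero_le_one fun u hu => ?_
  have h1 := sub_nonneg.2 (h.mul_lslSlope_le hu)
  have h2 := sub_nonneg.2 (h.div_le_one hu)
  have h3 := lslSlope_nonneg δ u
  have h4 := hu.1
  positivity

end IsLSLDiagonal

/-! ### Continuous distribution functions -/

open scoped Topology in
/-- The probability integral transform. -/
theorem map_continuous_cdf (μ : Measure ℝ) [IsProbabilityMeasure μ]
    (hF : Continuous fun x => μ.real (Iic x)) :
    μ.map (fun x => μ.real (Iic x)) = volume.restrict (Ioc 0 1) := by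
  set F : ℝ → ℝ := fun x => μ.real (Iic x) with hFdef
  have hmono : Monotone F := fun x y hxy => measureReal_mono (Iic_subset_Iic.2 hxy)
  have htop : Filter.Tendsto F Filter.atTop (𝓝 1) := by
    simpa only [hFdef, ← cdf_eq_real] using tendsto_cdf_atTop μ
  have hbot : Filter.Tendsto F Filter.atBot (𝓝 0) := by
    simpa only [hFdef, ← cdf_eq_real] using tendsto_cdf_atBot μ
  have : IsProbabilityMeasure (μ.map F) :=
    Measure.isProbabilityMeasure_map hF.measurable.aemeasurable
  refine Measure.ext_of_Iic _ _ fun t => ?_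
  rw [Measure.map_apply hF.measurable measurableSet_Iic,
    Measure.restrict_apply measurableSet_Iic]
  -- `F` need not be injective: the sublevel set is a closed half-line `Iic m`, where `m` is the
  -- largest point with `F m = s`, a value attained by continuity.
  have key : ∀ s ∈ Ioo (0 : ℝ) 1, μ (F ⁻¹' Iic s) = ENNReal.ofReal s := by
    intro s hs
    obtain ⟨b, hb⟩ := (htop.eventually_const_lt hs.2).exists
    obtain ⟨a, ha⟩ := (hbot.eventually_lt_const hs.1).exists
    have hne : (F ⁻¹' Iic s).Nonempty := ⟨a, ha.le⟩
    have hbdd : BddAbove (F ⁻¹' Iic s) :=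
      ⟨b, fun x hx => le_of_not_gt fun hbx => (hb.trans_le (hmono hbx.le)).not_ge hx⟩
    set m := sSup (F ⁻¹' Iic s)
    have hm : F m ≤ s := (isClosed_Iic.preimage hF).csSup_mem hne hbdd
    have heq : F ⁻¹' Iic s = Iic m :=
      Subset.antisymm (fun x hx => le_csSup hbdd hx) fun x hx => (hmono hx).trans hm
    obtain ⟨x, hx⟩ := mem_range_of_exists_le_of_exists_ge hF ⟨a, ha.le⟩ ⟨b, hb.le⟩
    have hxm : x ≤ m := le_csSup hbdd hx.le
    rw [heq, ← le_antisymm hm (hx ▸ hmono hxm)]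
    simp [hFdef]
  rcases le_or_gt 1 t with ht1 | ht1
  · have h1 : F ⁻¹' Iic t = univ := eq_univ_of_forall fun x => measureReal_le_one.trans ht1
    have h2 : Iic t ∩ Ioc 0 1 = Ioc (0 : ℝ) 1 :=
      inter_eq_right.2 fun x hx => hx.2.trans ht1
    rw [h1, h2]
    simp
  · rcases le_or_gt t 0 with ht0 | ht0
    · have h2 : Iic t ∩ Ioc 0 1 = (∅ : Set ℝ) :=
        eq_empty_of_forall_notMem fun x hx => (hx.2.1.trans_le (hx.1.trans ht0)).false
      rw [h2, measure_empty, ← nonpos_iff_eq_zero]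
      -- For `t ≤ 0` the sublevel set lies in those of arbitrarily small levels `r > 0`, to which
      -- `key` applies.
      refine le_of_forall_pos_le_add fun ε hε => ?_
      rw [zero_add]
      rcases eq_or_ne ε ⊤ with rfl | hεt
      · exact le_top
      · set r := min ε.toReal (1 / 2)
        have hr : r ∈ Ioo (0 : ℝ) 1 :=
          ⟨lt_min (ENNReal.toReal_pos hε.ne' hεt) (by norm_num),
            (min_le_right _ _).trans_lt (by norm_num)⟩
        calc μ (F ⁻¹' Iic t) ≤ μ (F ⁻¹' Iic r) :=
              measure_mono (preimage_mono (Iic_subset_Iic.2 (ht0.trans hr.1.le)))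
          _ = ENNReal.ofReal r := key r hr
          _ ≤ ENNReal.ofReal ε.toReal := ENNReal.ofReal_le_ofReal (min_le_left _ _)
          _ = ε := ENNReal.ofReal_toReal hεt
    · have h2 : Iic t ∩ Ioc 0 1 = Ioc (0 : ℝ) t := by
        ext x
        exact ⟨fun hx => ⟨hx.2.1, hx.1⟩, fun hx => ⟨hx.2, hx.1, hx.2.trans ht1.le⟩⟩
      rw [key t ⟨ht0, ht1⟩, h2]
      simp

/-- The sets can differ only where the distribution function is flat to the right of `x`; the
probability integral transform shows that they have equal mass. -/
theorem preimage_Iic_cdf_ae_eq (μ : Measure ℝ) [IsProbabilityMeasure μ]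
    (hF : Continuous fun x => μ.real (Iic x)) (x : ℝ) :
    (fun x => μ.real (Iic x)) ⁻¹' Iic (μ.real (Iic x)) =ᵐ[μ] Iic x := by
  refine (ae_eq_of_subset_of_measure_ge (fun y hy => ?_) ?_ measurableSet_Iic.nullMeasurableSet
    (measure_ne_top _ _)).symm
  · exact measureReal_mono (Iic_subset_Iic.2 hy)
  · rw [← Measure.map_apply hF.measurable measurableSet_Iic, map_continuous_cdf μ hF,
      Measure.restrict_apply measurableSet_Iic]
    calc volume (Iic (μ.real (Iic x)) ∩ Ioc 0 1) ≤ volume (Ioc 0 (μ.real (Iic x))) :=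
          measure_mono fun y hy => ⟨hy.2.1, hy.1⟩
      _ = μ (Iic x) := by simp

/-! ### Chatterjee's correlation as an integral of the kernel -/

section

variable {Ω : Type*} [MeasurableSpace Ω] {P : Measure Ω} [IsProbabilityMeasure P]

theorem map_measureReal_setOf_le {X : Ω → ℝ} (hX : Measurable X)
    (hF : Continuous fun x : ℝ => P.real {ω | X ω ≤ x}) :
    (P.map X).map (fun x => P.real {ω | X ω ≤ x}) = volume.restrict (Ioc 0 1) := by
  have := Measure.isProbabilityMeasure_map (μ := P) hX.aemeasurable
  have he : (fun x => P.real {ω | X ω ≤ x}) = fun x => (P.map X).real (Iic x) := by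
    ext x
    rw [map_measureReal_apply hX measurableSet_Iic]
    rfl
  rw [he] at hF ⊢
  exact map_continuous_cdf _ hF

theorem integral_comp_measureReal_setOf_le {X : Ω → ℝ} (hX : Measurable X)
    (hF : Continuous fun x : ℝ => P.real {ω | X ω ≤ x}) {f : ℝ → ℝ} (hf : Measurable f) :
    ∫ x, f (P.real {ω | X ω ≤ x}) ∂(P.map X) = ∫ u in (0 : ℝ)..1, f u := by
  rw [intervalIntegral.integral_of_le zero_le_one, ← map_measureReal_setOf_le hX hF,
    integral_map hF.measurable.aemeasurable hf.aestronglyMeasurable]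

/-- The conditional distribution of `X` on `{Y ≤ y}` has density `k (F_X x)`, if `k` is a
density of `C (·, F_Y y)`. -/
theorem HasCopula.map_restrict {X Y : Ω → ℝ} {C : ℝ → ℝ → ℝ} (h : HasCopula P X Y C)
    {k : ℝ → ℝ} (hk : Measurable k) (hk01 : ∀ u, k u ∈ Icc (0 : ℝ) 1) (y : ℝ)
    (hC : ∀ t ∈ Icc (0 : ℝ) 1, ∫ u in (0 : ℝ)..t, k u = C t (P.real {ω | Y ω ≤ y})) :
    (P.restrict {ω | Y ω ≤ y}).map X =
      (P.map X).withDensity fun x => ENNReal.ofReal (k (P.real {ω | X ω ≤ x})) := by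
  have hX := h.measurable_fst
  have hF := h.continuous_fst
  have := Measure.isProbabilityMeasure_map (μ := P) hX.aemeasurable
  refine Measure.ext_of_Iic _ _ fun x => ?_
  have hFe : (fun x => P.real {ω | X ω ≤ x}) = fun x => (P.map X).real (Iic x) := by
    ext x
    rw [map_measureReal_apply hX measurableSet_Iic]
    rfl
  -- Replacing `Iic x` by a preimage under `F_X` lets the integral be transported to the uniform law
  -- on `(0,1]`.
  have hae := preimage_Iic_cdf_ae_eq (P.map X) (hFe ▸ hF) x
  rw [← hFe] at hae
  have hFx : (P.map X).real (Iic x) = P.real {ω | X ω ≤ x} := (congrFun hFe x).symm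
  have ht : P.real {ω | X ω ≤ x} ∈ Icc (0 : ℝ) 1 := ⟨measureReal_nonneg, measureReal_le_one⟩
  have hs : Iic (P.real {ω | X ω ≤ x}) ∩ Ioc (0 : ℝ) 1 = Ioc 0 (P.real {ω | X ω ≤ x}) := by
    ext u
    exact ⟨fun hu => ⟨hu.2.1, hu.1⟩, fun hu => ⟨hu.2, hu.1, hu.2.trans ht.2⟩⟩
  rw [Measure.map_apply hX measurableSet_Iic,
    Measure.restrict_apply (hX measurableSet_Iic), withDensity_apply _ measurableSet_Iic,
    ← Measure.restrict_congr_set hae, hFx,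
    ← setLIntegral_map (f := fun u => ENNReal.ofReal (k u)) measurableSet_Iic (by fun_prop)
      hF.measurable,
    map_measureReal_setOf_le hX hF, Measure.restrict_restrict measurableSet_Iic, hs,
    ← ofReal_integral_eq_lintegral_ofReal, ← intervalIntegral.integral_of_le ht.1, hC _ ht,
    ← h.joint, ofReal_measureReal]
  · rfl
  · exact Integrable.of_bound hk.aestronglyMeasurable 1 (.of_forall fun u => by
      rw [Real.norm_of_nonneg (hk01 u).1]; exact (hk01 u).2)
  · exact .of_forall fun u => (hk01 u).1

/-- Every event of the σ-algebra of `X` is some `X ⁻¹' A`, and evaluating `HasCopula.map_restrict`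
at `A` is the defining identity of the conditional expectation. -/
theorem HasCopula.condExp_ae_eq {X Y : Ω → ℝ} {C : ℝ → ℝ → ℝ} (h : HasCopula P X Y C)
    {k : ℝ → ℝ} (hk : Measurable k) (hk01 : ∀ u, k u ∈ Icc (0 : ℝ) 1) (y : ℝ)
    (hC : ∀ t ∈ Icc (0 : ℝ) 1, ∫ u in (0 : ℝ)..t, k u = C t (P.real {ω | Y ω ≤ y})) :
    (fun ω => k (P.real {ω' | X ω' ≤ X ω})) =ᵐ[P]
      P[({ω | Y ω ≤ y}).indicator (fun _ => (1 : ℝ)) | MeasurableSpace.comap X inferInstance] := by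
  have hX := h.measurable_fst
  have hF := h.continuous_fst
  have hYs : MeasurableSet {ω | Y ω ≤ y} := h.measurable_snd measurableSet_Iic
  have hkF : Measurable fun x => k (P.real {ω' | X ω' ≤ x}) := hk.comp hF.measurable
  have hint : Integrable (fun ω => k (P.real {ω' | X ω' ≤ X ω})) P :=
    Integrable.of_bound (hkF.comp hX).aestronglyMeasurable 1 (.of_forall fun ω => by
      rw [Real.norm_of_nonneg (hk01 _).1]; exact (hk01 _).2)
  refine ae_eq_condExp_of_forall_setIntegral_eq hX.comap_le
    ((integrable_const (1 : ℝ)).indicator hYs) (fun _ _ _ => hint.integrableOn) ?_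
    (hkF.comp (comap_measurable X)).aestronglyMeasurable
  rintro _ ⟨A, hA, rfl⟩ -
  have hmap := congrArg (fun ν => (ν A).toReal) (h.map_restrict hk hk01 y hC)
  rw [Measure.map_apply hX hA, Measure.restrict_apply (hX hA), withDensity_apply _ hA,
    setLIntegral_map hA hkF.ennreal_ofReal hX, ← ofReal_integral_eq_lintegral_ofReal hint.integrableOn
      (.of_forall fun ω => (hk01 _).1),
    ENNReal.toReal_ofReal (integral_nonneg fun ω => (hk01 _).1)] at hmap
  rw [← hmap, setIntegral_indicator hYs]
  simp [measureReal_def]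

theorem variance_comp_measureReal_setOf_le {X : Ω → ℝ} (hX : Measurable X)
    (hF : Continuous fun x : ℝ => P.real {ω | X ω ≤ x}) {k : ℝ → ℝ} (hk : Measurable k)
    (hk01 : ∀ u, k u ∈ Icc (0 : ℝ) 1) :
    variance (fun ω => k (P.real {ω' | X ω' ≤ X ω})) P =
      (∫ u in (0 : ℝ)..1, k u ^ 2) - (∫ u in (0 : ℝ)..1, k u) ^ 2 := by
  have hkF : Measurable fun x => k (P.real {ω' | X ω' ≤ x}) := hk.comp hF.measurable
  rw [variance_eq_sub]
  · congr 1
    · rw [← integral_comp_measureReal_setOf_le hX hF (hk.pow_const 2),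
        integral_map hX.aemeasurable (hkF.pow_const 2).aestronglyMeasurable]
      rfl
    · rw [← integral_comp_measureReal_setOf_le hX hF hk,
        integral_map hX.aemeasurable hkF.aestronglyMeasurable]
  · exact MemLp.of_bound (hkF.comp hX).aestronglyMeasurable 1 (.of_forall fun ω => by
      rw [Real.norm_of_nonneg (hk01 _).1]; exact (hk01 _).2)

theorem measure_preimage_singleton_eq_zero {Y : Ω → ℝ} (hY : Measurable Y)
    (hF : Continuous fun y : ℝ => P.real {ω | Y ω ≤ y}) (y : ℝ) : P (Y ⁻¹' {y}) = 0 := by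
  have := Measure.isProbabilityMeasure_map (μ := P) hY.aemeasurable
  have he : (fun x => P.real {ω | Y ω ≤ x}) = cdf (P.map Y) := by
    ext x
    rw [cdf_eq_real, map_measureReal_apply hY measurableSet_Iic]
    rfl
  rw [← Measure.map_apply hY (measurableSet_singleton y), ← measure_cdf (P.map Y),
    StieltjesFunction.measure_singleton, ← he, hF.continuousAt.continuousWithinAt.leftLim_eq]
  simp

/-- Since `Y` has no atoms, the event `y ≤ Y` in the definition of `ξ` can be exchanged for the
complement of `Y ≤ y`, which the copula describes; variances do not see `1 - ·`. -/
theorem indicator_le_ae_eq {Y : Ω → ℝ} (hY : Measurable Y)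
    (hF : Continuous fun y : ℝ => P.real {ω | Y ω ≤ y}) (y : ℝ) :
    ({ω | y ≤ Y ω}).indicator (fun _ => (1 : ℝ)) =ᵐ[P]
      fun ω => 1 - ({ω | Y ω ≤ y}).indicator (fun _ => (1 : ℝ)) ω := by
  have h0 : ∀ᵐ ω ∂P, Y ω ≠ y := measure_eq_zero_iff_ae_notMem.1
    (measure_preimage_singleton_eq_zero hY hF y)
  filter_upwards [h0] with ω hω
  rcases lt_or_gt_of_ne hω with h | h
  · simp [indicator, h.le, h.not_ge]
  · simp [indicator, h.le, h.not_ge]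

/-- If `k v` is a density of `C (·, v)` for each `v`, then Chatterjee's rank correlation is
`6 ∫∫ k² - 2`. -/
theorem HasCopula.chatterjeeXi_eq {X Y : Ω → ℝ} {C : ℝ → ℝ → ℝ} (h : HasCopula P X Y C)
    {k : ℝ → ℝ → ℝ} (hk : Measurable (Function.uncurry k))
    (hk01 : ∀ v ∈ Icc (0 : ℝ) 1, ∀ u, k v u ∈ Icc (0 : ℝ) 1)
    (hC : ∀ t ∈ Icc (0 : ℝ) 1, ∀ v ∈ Icc (0 : ℝ) 1, ∫ u in (0 : ℝ)..t, k v u = C t v) :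
    chatterjeeXi P X Y = 6 * (∫ v in (0 : ℝ)..1, ∫ u in (0 : ℝ)..1, k v u ^ 2) - 2 := by
  have hX := h.measurable_fst
  have hF := h.continuous_fst
  have hY := h.measurable_snd
  have hG := h.continuous_snd
  have hYs (y : ℝ) : MeasurableSet {ω | Y ω ≤ y} := hY measurableSet_Iic
  have hG01 (y : ℝ) : P.real {ω | Y ω ≤ y} ∈ Icc (0 : ℝ) 1 :=
    ⟨measureReal_nonneg, measureReal_le_one⟩
  have hkv (v : ℝ) : Measurable (k v) := hk.comp measurable_prodMk_left
  have hnum (y : ℝ) : variance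
      (P[({ω | y ≤ Y ω}).indicator (fun _ => (1 : ℝ)) | MeasurableSpace.comap X inferInstance]) P =
      (∫ u in (0 : ℝ)..1, k (P.real {ω | Y ω ≤ y}) u ^ 2) - P.real {ω | Y ω ≤ y} ^ 2 := by
    have hk' := hk01 _ (hG01 y)
    have hce := h.condExp_ae_eq (hkv _) hk' y fun t ht => hC t ht _ (hG01 y)
    have hi : Integrable (({ω | Y ω ≤ y}).indicator (fun _ => (1 : ℝ))) P :=
      (integrable_const (1 : ℝ)).indicator (hYs y)
    have h1 : P[({ω | y ≤ Y ω}).indicator (fun _ => (1 : ℝ)) |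
        MeasurableSpace.comap X inferInstance] =ᵐ[P]
        fun ω => 1 - k (P.real {ω | Y ω ≤ y}) (P.real {ω' | X ω' ≤ X ω}) := by
      refine (condExp_congr_ae (indicator_le_ae_eq hY hG y)).trans
        ((condExp_sub (integrable_const 1) hi _).trans ?_)
      filter_upwards [hce] with ω hω
      rw [Pi.sub_apply, ← hω, condExp_const hX.comap_le]
    have hkF : Measurable fun x => k (P.real {ω | Y ω ≤ y}) (P.real {ω' | X ω' ≤ x}) :=
      (hkv _).comp hF.measurable
    have hmean : ∫ u in (0 : ℝ)..1, k (P.real {ω | Y ω ≤ y}) u = P.real {ω | Y ω ≤ y} := by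
      rw [← integral_comp_measureReal_setOf_le hX hF (hkv _), integral_map hX.aemeasurable
        hkF.aestronglyMeasurable, integral_congr_ae hce,
        integral_condExp hX.comap_le]
      exact integral_indicator_one (hYs y)
    rw [variance_congr h1, variance_const_sub (X := fun ω => k (P.real {ω | Y ω ≤ y}) (P.real {ω' | X ω' ≤ X ω}))
        (hkF.comp hX).aestronglyMeasurable,
      variance_comp_measureReal_setOf_le hX hF (hkv _) hk', hmean]
  have hden (y : ℝ) : variance (({ω | y ≤ Y ω}).indicator (fun _ => (1 : ℝ))) P =
      P.real {ω | Y ω ≤ y} - P.real {ω | Y ω ≤ y} ^ 2 := by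
    have hm : Measurable (({ω | Y ω ≤ y}).indicator (fun _ => (1 : ℝ))) :=
      measurable_const.indicator (hYs y)
    rw [variance_congr (indicator_le_ae_eq hY hG y), variance_const_sub hm.aestronglyMeasurable,
      variance_eq_sub]
    · congr 1
      · rw [← integral_indicator_one (hYs y)]
        congr 1
        ext ω
        by_cases hω : Y ω ≤ y <;> simp [hω]
      · rw [← integral_indicator_one (hYs y)]
        rfl
    · exact memLp_indicator_const 2 (hYs y) 1 (Or.inr (measure_ne_top _ _))
  have hksq : Measurable fun v => ∫ u in (0 : ℝ)..1, k v u ^ 2 := by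
    simp only [intervalIntegral.integral_of_le zero_le_one]
    exact (StronglyMeasurable.integral_prod_right
      (f := fun v u => k v u ^ 2) (hk.pow_const 2).stronglyMeasurable).measurable
  have hksqi : IntervalIntegrable (fun v => ∫ u in (0 : ℝ)..1, k v u ^ 2) volume 0 1 := by
    refine intervalIntegrable_of_forall_abs_le_one hksq fun v hv => ?_
    refine (intervalIntegral.norm_integral_le_of_norm_le_const (a := 0) (b := 1)
      (f := fun u => k v u ^ 2) (C := 1) fun u _ => ?_).trans (by simp)
    rw [Real.norm_of_nonneg (sq_nonneg _)]
    exact pow_le_one₀ (hk01 v hv u).1 (hk01 v hv u).2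
  rw [chatterjeeXi]
  simp_rw [hnum, hden]
  rw [integral_comp_measureReal_setOf_le hY hG
      (f := fun v => (∫ u in (0 : ℝ)..1, k v u ^ 2) - v ^ 2) (by fun_prop),
    integral_comp_measureReal_setOf_le hY hG (f := fun v => v - v ^ 2) (by fun_prop),
    intervalIntegral.integral_sub hksqi ((by fun_prop : Continuous _).intervalIntegrable _ _),
    intervalIntegral.integral_sub ((by fun_prop : Continuous _).intervalIntegrable _ _)
      ((by fun_prop : Continuous _).intervalIntegrable _ _), integral_pow, integral_id]
  -- The numerator is `∫∫ k² - 1/3` and the denominator `1/2 - 1/3 = 1/6`.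
  norm_num
  ring

end

/-! ### A law with copula `S_δ` -/

theorem restrict_Ioc_zero_one_restrict_Iic {a : ℝ} (ha : a ≤ 1) :
    ((volume : Measure ℝ).restrict (Ioc 0 1)).restrict (Iic a) = volume.restrict (Ioc 0 a) := by
  rw [Measure.restrict_restrict measurableSet_Iic]
  congr 1
  ext x
  exact ⟨fun hx => ⟨hx.2.1, hx.1⟩, fun hx => ⟨hx.2, hx.1, hx.2.trans ha⟩⟩

/-- The part of the law with copula `S_δ` that lives below the diagonal. -/
noncomputable def lslLowerMeasure (δ : ℝ → ℝ) : Measure (ℝ × ℝ) :=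
  ((volume.restrict (Ioc 0 1)).prod (volume.restrict (Ioc 0 1))).withDensity
    fun p => if p.2 < p.1 then ENNReal.ofReal (lslSlope δ p.1) else 0

/-- The projection of the part of the law with copula `S_δ` that lives on the diagonal. -/
noncomputable def lslDiagMeasure (δ : ℝ → ℝ) : Measure ℝ :=
  (volume.restrict (Ioc 0 1)).withDensity fun u => ENNReal.ofReal (δ u / u - u * lslSlope δ u)

/-- A law on the unit square with distribution function `S_δ`. -/
noncomputable def lslMeasure (δ : ℝ → ℝ) : Measure (ℝ × ℝ) :=
  lslLowerMeasure δ + (lslLowerMeasure δ).map Prod.swap +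
    (lslDiagMeasure δ).map fun u => (u, u)

/-- The density does not depend on the second coordinate, whose slice below both `x` and `b` has
length `min x b`. -/
theorem lslLowerMeasure_prod {δ : ℝ → ℝ} (hδ : Measurable δ) {a b : ℝ} (ha : a ≤ 1)
    (hb : b ∈ Icc (0 : ℝ) 1) :
    lslLowerMeasure δ (Iic a ×ˢ Iic b) =
      ∫⁻ x in Ioc 0 a, ENNReal.ofReal (min x b * lslSlope δ x) := by
  have hγ := measurable_lslSlope hδ
  have hm : Measurable fun p : ℝ × ℝ =>
      if p.2 < p.1 then ENNReal.ofReal (lslSlope δ p.1) else 0 :=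
    Measurable.ite (measurableSet_lt measurable_snd measurable_fst) (by fun_prop) measurable_const
  rw [lslLowerMeasure, withDensity_apply _ (measurableSet_Iic.prod measurableSet_Iic),
    ← Measure.prod_restrict, restrict_Ioc_zero_one_restrict_Iic ha,
    restrict_Ioc_zero_one_restrict_Iic hb.2, lintegral_prod _ hm.aemeasurable]
  refine setLIntegral_congr_fun measurableSet_Ioc fun x hx => ?_
  have he : (fun y => if y < x then ENNReal.ofReal (lslSlope δ x) else 0) =
      (Iio x).indicator fun _ => ENNReal.ofReal (lslSlope δ x) := by
    ext y
    simp [indicator]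
  simp only [he]
  rw [lintegral_indicator measurableSet_Iio, setLIntegral_const,
    Measure.restrict_apply measurableSet_Iio, mul_comm,
    ENNReal.ofReal_mul (le_min hx.1.le hb.1)]
  congr 1
  rw [inter_comm]
  rcases le_or_gt x b with hxb | hxb
  · have : Ioc 0 b ∩ Iio x = Ioo 0 x := by
      ext y
      exact ⟨fun hy => ⟨hy.1.1, hy.2⟩, fun hy => ⟨⟨hy.1, hy.2.le.trans hxb⟩, hy.2⟩⟩
    rw [this, min_eq_left hxb]
    simp
  · have : Ioc 0 b ∩ Iio x = Ioc 0 b :=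
      inter_eq_left.2 fun y hy => hy.2.trans_lt hxb
    rw [this, min_eq_right hxb.le]
    simp

theorem map_swap_lslMeasure (δ : ℝ → ℝ) : (lslMeasure δ).map Prod.swap = lslMeasure δ := by
  have hd : Measurable fun u : ℝ => (u, u) := by fun_prop
  rw [lslMeasure, Measure.map_add _ _ measurable_swap, Measure.map_add _ _ measurable_swap,
    Measure.map_map measurable_swap measurable_swap, Measure.map_map measurable_swap hd,
    Prod.swap_swap_eq, Measure.map_id, add_comm ((lslLowerMeasure δ).map _)]
  rfl

theorem lslMeasure_compl_prod (δ : ℝ → ℝ) :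
    lslMeasure δ (Ioc (0 : ℝ) 1 ×ˢ Ioc (0 : ℝ) 1)ᶜ = 0 := by
  have hd : Measurable fun u : ℝ => (u, u) := by fun_prop
  have hS : MeasurableSet (Ioc (0 : ℝ) 1 ×ˢ Ioc (0 : ℝ) 1)ᶜ :=
    (measurableSet_Ioc.prod measurableSet_Ioc).compl
  have h1 : lslLowerMeasure δ (Ioc (0 : ℝ) 1 ×ˢ Ioc (0 : ℝ) 1)ᶜ = 0 := by
    refine withDensity_absolutelyContinuous _ _ ?_
    rw [Measure.prod_restrict, Measure.restrict_apply hS, compl_inter_self, measure_empty]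
  have h2 : Prod.swap ⁻¹' (Ioc (0 : ℝ) 1 ×ˢ Ioc (0 : ℝ) 1)ᶜ =
      (Ioc (0 : ℝ) 1 ×ˢ Ioc (0 : ℝ) 1)ᶜ := by
    rw [preimage_compl, preimage_swap_prod]
  have h3 : lslDiagMeasure δ ((fun u : ℝ => (u, u)) ⁻¹' (Ioc (0 : ℝ) 1 ×ˢ Ioc (0 : ℝ) 1)ᶜ) = 0 := by
    refine withDensity_absolutelyContinuous _ _ ?_
    rw [Measure.restrict_apply (hd hS)]
    convert! measure_empty (μ := (volume : Measure ℝ)) using 2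
    ext u
    simp +contextual
  simp only [lslMeasure, Measure.add_apply, Measure.map_apply measurable_swap hS,
    Measure.map_apply hd hS, h1, h2, h3, add_zero]

namespace IsLSLDiagonal

variable {δ : ℝ → ℝ}

theorem lowerSemilinear_nonneg (h : IsLSLDiagonal δ) {u v : ℝ} (hu : u ∈ Icc (0 : ℝ) 1)
    (hv : v ∈ Icc (0 : ℝ) 1) : 0 ≤ lowerSemilinear δ u v := by
  unfold lowerSemilinear
  split_ifs
  · exact mul_nonneg hv.1 (h.div_nonneg hu)
  · exact mul_nonneg hu.1 (h.div_nonneg hv)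

theorem lowerSemilinear_one_right (h : IsLSLDiagonal δ) {u : ℝ} (hu : u ≤ 1) :
    lowerSemilinear δ u 1 = u := by
  unfold lowerSemilinear
  split_ifs with h1
  · rw [le_antisymm hu h1, h.map_one]
    norm_num
  · rw [h.map_one, div_one, mul_one]

/-- With `g` the quotient and `γ` the slope, the two triangles and the diagonal contribute `xγ + xγ
+ (g - xγ) = δ'` on `(0, b]`, in total `δ b = b g(b)`. On `(b, a]` only the lower triangle
contributes, namely `b γ`, in total `b (g(a) - g(b))`. -/
theorem lslMeasure_prod (h : IsLSLDiagonal δ) (hL : LipschitzWith 2 δ) {a b : ℝ}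
    (ha : a ∈ Icc (0 : ℝ) 1) (hb : b ∈ Icc (0 : ℝ) 1) (hba : b ≤ a) :
    lslMeasure δ (Iic a ×ˢ Iic b) = ENNReal.ofReal (b * (δ a / a)) := by
  have hδ : Measurable δ := hL.continuous.measurable
  have hγ := measurable_lslSlope hδ
  have hd : Measurable fun u : ℝ => (u, u) := by fun_prop
  have hS : MeasurableSet (Iic a ×ˢ Iic b) := measurableSet_Iic.prod measurableSet_Iic
  have hpre : (fun u : ℝ => (u, u)) ⁻¹' (Iic a ×ˢ Iic b) = Iic b := by
    ext u
    exact ⟨fun hu => hu.2, fun hu => ⟨le_trans hu hba, hu⟩⟩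
  have hdiag : lslDiagMeasure δ (Iic b) =
      ∫⁻ x in Ioc 0 b, ENNReal.ofReal (δ x / x - x * lslSlope δ x) := by
    rw [lslDiagMeasure, withDensity_apply _ measurableSet_Iic,
      restrict_Ioc_zero_one_restrict_Iic hb.2]
  have hlow : ∫⁻ x in Ioc 0 a, ENNReal.ofReal (min x b * lslSlope δ x) =
      (∫⁻ x in Ioc 0 b, ENNReal.ofReal (x * lslSlope δ x)) +
        ∫⁻ x in Ioc b a, ENNReal.ofReal (b * lslSlope δ x) := by
    rw [← Ioc_union_Ioc_eq_Ioc hb.1 hba, lintegral_union measurableSet_Ioc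
      (Ioc_disjoint_Ioc_of_le le_rfl)]
    congr 1
    · exact setLIntegral_congr_fun measurableSet_Ioc fun x hx => by
        simp only [min_eq_left hx.2]
    · exact setLIntegral_congr_fun measurableSet_Ioc fun x hx => by
        simp only [min_eq_right hx.1.le]
  have hup : ∫⁻ x in Ioc 0 b, ENNReal.ofReal (min x a * lslSlope δ x) =
      ∫⁻ x in Ioc 0 b, ENNReal.ofReal (x * lslSlope δ x) :=
    setLIntegral_congr_fun measurableSet_Ioc fun x hx => by
      simp only [min_eq_left (hx.2.trans hba)]
  have hfirst : ∫⁻ x in Ioc 0 b, ENNReal.ofReal (δ x / x + x * lslSlope δ x) =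
      ENNReal.ofReal (δ b) := by
    obtain ⟨hi, he⟩ := h.integral_deriv hL hb
    rw [← he, intervalIntegral.integral_of_le hb.1, ofReal_integral_eq_lintegral_ofReal
      ((intervalIntegrable_iff_integrableOn_Ioc_of_le hb.1).1 hi)]
    refine ae_restrict_of_forall_mem measurableSet_Ioc fun x hx => ?_
    exact add_nonneg (h.div_nonneg ⟨hx.1.le, hx.2.trans hb.2⟩)
      (mul_nonneg hx.1.le (lslSlope_nonneg δ x))
  have hsecond : ∫⁻ x in Ioc b a, ENNReal.ofReal (b * lslSlope δ x) =
      ENNReal.ofReal (b * (δ a / a - δ b / b)) := by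
    rcases hb.1.eq_or_lt with rfl | hb0
    · simp
    · obtain ⟨hi, he⟩ := h.integral_lslSlope hL hb0 hba ha.2
      rw [← he, ← intervalIntegral.integral_const_mul, intervalIntegral.integral_of_le hba,
        ofReal_integral_eq_lintegral_ofReal
          ((intervalIntegrable_iff_integrableOn_Ioc_of_le hba).1 (hi.const_mul b))]
      exact .of_forall fun x => mul_nonneg hb.1 (lslSlope_nonneg δ x)
  have hge : 0 ≤ b * (δ a / a - δ b / b) := by
    rcases hb.1.eq_or_lt with rfl | hb0
    · simp
    · exact mul_nonneg hb.1 (sub_nonneg.2 (h.monotoneOn_div ⟨hb0, hb.2⟩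
        ⟨hb0.trans_le hba, ha.2⟩ hba))
  have hsum : (∫⁻ x in Ioc 0 b, ENNReal.ofReal (x * lslSlope δ x)) +
      (∫⁻ x in Ioc 0 b, ENNReal.ofReal (x * lslSlope δ x)) +
      (∫⁻ x in Ioc 0 b, ENNReal.ofReal (δ x / x - x * lslSlope δ x)) =
      ENNReal.ofReal (δ b) := by
    rw [← hfirst, ← lintegral_add_left (by fun_prop), ← lintegral_add_left (by fun_prop)]
    refine setLIntegral_congr_fun measurableSet_Ioc fun x hx => ?_
    have hx' : x ∈ Icc (0 : ℝ) 1 := ⟨hx.1.le, hx.2.trans hb.2⟩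
    have h1 := mul_nonneg hx'.1 (lslSlope_nonneg δ x)
    have h2 := sub_nonneg.2 (h.mul_lslSlope_le hx')
    rw [← ENNReal.ofReal_add h1 h1, ← ENNReal.ofReal_add (add_nonneg h1 h1) h2]
    congr 1
    ring
  rw [lslMeasure, Measure.add_apply, Measure.add_apply, Measure.map_apply measurable_swap hS,
    Measure.map_apply hd hS, preimage_swap_prod, hpre, hdiag, lslLowerMeasure_prod hδ ha.2 hb,
    lslLowerMeasure_prod hδ hb.2 ha, hlow, hup, hsecond,
    add_right_comm _ (ENNReal.ofReal _), add_right_comm _ (ENNReal.ofReal _), hsum,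
    ← ENNReal.ofReal_add (h.nonneg b hb) hge]
  congr 1
  linarith [h.mul_div_self b]

theorem lslMeasure_prod_eq_lowerSemilinear (h : IsLSLDiagonal δ) (hL : LipschitzWith 2 δ)
    {a b : ℝ} (ha : a ∈ Icc (0 : ℝ) 1) (hb : b ∈ Icc (0 : ℝ) 1) :
    lslMeasure δ (Iic a ×ˢ Iic b) = ENNReal.ofReal (lowerSemilinear δ a b) := by
  unfold lowerSemilinear
  split_ifs with hba
  · exact h.lslMeasure_prod hL ha hb hba
  · rw [← map_swap_lslMeasure, Measure.map_apply measurable_swap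
      (measurableSet_Iic.prod measurableSet_Iic), preimage_swap_prod]
    exact h.lslMeasure_prod hL hb ha (not_le.1 hba).le

theorem isProbabilityMeasure_lslMeasure (h : IsLSLDiagonal δ) (hL : LipschitzWith 2 δ) :
    IsProbabilityMeasure (lslMeasure δ) := by
  refine ⟨?_⟩
  have hae : (univ : Set (ℝ × ℝ)) =ᵐ[lslMeasure δ] Iic 1 ×ˢ Iic 1 := by
    filter_upwards [measure_eq_zero_iff_ae_notMem.1 (lslMeasure_compl_prod δ)] with p hp
    rw [mem_compl_iff, not_not] at hp
    exact propext ⟨fun _ => ⟨hp.1.2, hp.2.2⟩, fun _ => trivial⟩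
  rw [measure_congr hae, h.lslMeasure_prod_eq_lowerSemilinear hL (by simp) (by simp),
    h.lowerSemilinear_one_right le_rfl, ENNReal.ofReal_one]

theorem hasCopula_lslMeasure (h : IsLSLDiagonal δ) (hL : LipschitzWith 2 δ) :
    HasCopula (lslMeasure δ) Prod.fst Prod.snd (lowerSemilinear δ) := by
  -- The clamp of `x` to `[0,1]` is the distribution function of the uniform marginals.
  have hcl (x : ℝ) : max 0 (min x 1) ∈ Icc (0 : ℝ) 1 :=
    ⟨le_max_left _ _, max_le zero_le_one (min_le_right _ _)⟩
  have hS := measure_eq_zero_iff_ae_notMem.1 (lslMeasure_compl_prod δ)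
  have hiff {t x : ℝ} (ht : t ∈ Ioc (0 : ℝ) 1) : t ≤ max 0 (min x 1) ↔ t ≤ x := by
    rw [le_max_iff, le_min_iff]
    exact ⟨fun h => h.elim (fun h => absurd ht.1 h.not_gt) And.left, fun h => Or.inr ⟨h, ht.2⟩⟩
  have hjoint (x y : ℝ) : (lslMeasure δ).real {p : ℝ × ℝ | p.1 ≤ x ∧ p.2 ≤ y} =
      lowerSemilinear δ (max 0 (min x 1)) (max 0 (min y 1)) := by
    have hae : {p : ℝ × ℝ | p.1 ≤ x ∧ p.2 ≤ y} =ᵐ[lslMeasure δ]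
        Iic (max 0 (min x 1)) ×ˢ Iic (max 0 (min y 1)) := by
      filter_upwards [hS] with p hp
      rw [mem_compl_iff, not_not] at hp
      exact propext (and_congr (hiff hp.1).symm (hiff hp.2).symm)
    rw [measureReal_def, measure_congr hae,
      h.lslMeasure_prod_eq_lowerSemilinear hL (hcl x) (hcl y),
      ENNReal.toReal_ofReal (h.lowerSemilinear_nonneg (hcl x) (hcl y))]
  have hfst (x : ℝ) : (lslMeasure δ).real {p : ℝ × ℝ | p.1 ≤ x} = max 0 (min x 1) := by
    have hae : {p : ℝ × ℝ | p.1 ≤ x} =ᵐ[lslMeasure δ] {p : ℝ × ℝ | p.1 ≤ x ∧ p.2 ≤ 1} := by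
      filter_upwards [hS] with p hp
      rw [mem_compl_iff, not_not] at hp
      exact propext (and_iff_left hp.2.2).symm
    rw [measureReal_congr hae, hjoint, min_self, max_eq_right zero_le_one,
      h.lowerSemilinear_one_right (hcl x).2]
  have hsnd (y : ℝ) : (lslMeasure δ).real {p : ℝ × ℝ | p.2 ≤ y} = max 0 (min y 1) := by
    rw [← hfst, ← map_swap_lslMeasure, map_measureReal_apply measurable_swap
      (measurableSet_le measurable_snd measurable_const), map_swap_lslMeasure]
    rfl
  refine ⟨measurable_fst, measurable_snd, ?_, ?_, fun x y => ?_⟩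
  · simp_rw [hfst]
    fun_prop
  · simp_rw [hsnd]
    fun_prop
  · rw [hfst, hsnd, hjoint]

end IsLSLDiagonal

/-! ### Comparison of `ξ` and the footrule -/

theorem HasCopula.congr {Ω : Type*} [MeasurableSpace Ω] {P : Measure Ω} [IsProbabilityMeasure P]
    {X Y : Ω → ℝ} {C D : ℝ → ℝ → ℝ} (h : HasCopula P X Y C)
    (hCD : ∀ u ∈ Icc (0 : ℝ) 1, ∀ v ∈ Icc (0 : ℝ) 1, C u v = D u v) : HasCopula P X Y D where
  measurable_fst := h.measurable_fst
  measurable_snd := h.measurable_snd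
  continuous_fst := h.continuous_fst
  continuous_snd := h.continuous_snd
  joint x y := (h.joint x y).trans
    (hCD _ ⟨measureReal_nonneg, measureReal_le_one⟩ _ ⟨measureReal_nonneg, measureReal_le_one⟩)

theorem spearmanFootrule_congr {C D : ℝ → ℝ → ℝ}
    (hCD : ∀ u ∈ Icc (0 : ℝ) 1, ∀ v ∈ Icc (0 : ℝ) 1, C u v = D u v) :
    spearmanFootrule C = spearmanFootrule D := by
  rw [spearmanFootrule, spearmanFootrule,
    setIntegral_congr_fun measurableSet_Icc fun t ht => hCD t ht t ht]

namespace IsLSLDiagonal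

variable {δ : ℝ → ℝ} {Ω : Type*} [MeasurableSpace Ω] {P : Measure Ω} [IsProbabilityMeasure P]
  {X Y : Ω → ℝ}

theorem chatterjeeXi_eq (h : IsLSLDiagonal δ) (hL : LipschitzWith 2 δ)
    (hc : HasCopula P X Y (lowerSemilinear δ)) :
    chatterjeeXi P X Y =
      6 * (∫ v in (0 : ℝ)..1, ∫ u in (0 : ℝ)..1, lslKernel δ v u ^ 2) - 2 :=
  hc.chatterjeeXi_eq (measurable_lslKernel hL.continuous.measurable)
    (fun _ hv => h.lslKernel_mem_Icc hv) fun _ ht _ hv => h.integral_lslKernel hL ht hv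

theorem chatterjeeXi_le_spearmanFootrule (h : IsLSLDiagonal δ) (hL : LipschitzWith 2 δ)
    (hc : HasCopula P X Y (lowerSemilinear δ)) :
    chatterjeeXi P X Y ≤ spearmanFootrule (lowerSemilinear δ) := by
  rw [h.chatterjeeXi_eq hL hc, spearmanFootrule_lowerSemilinear h]
  linarith [h.integral_integral_lslKernel_sq_le hL]

/-- Each alternative in the hypothesis annihilates one of the two factors in the gap formula. -/
theorem chatterjeeXi_eq_spearmanFootrule (h : IsLSLDiagonal δ) (hL : LipschitzWith 2 δ)
    (hc : HasCopula P X Y (lowerSemilinear δ))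
    (hδ : ∀ᵐ u : ℝ, u ∈ Ioc (0 : ℝ) 1 → u * lslSlope δ u = δ u / u ∨
      δ u / u = 1 ∧ lslSlope δ u = 0) :
    chatterjeeXi P X Y = spearmanFootrule (lowerSemilinear δ) := by
  have h0 := h.integral_sub_integral_integral_lslKernel_sq hL
  rw [intervalIntegral.integral_zero_ae (f := fun u => (δ u / u - u * lslSlope δ u) *
    (u * (1 - δ u / u) + u ^ 2 * lslSlope δ u) / 3)] at h0
  · rw [h.chatterjeeXi_eq hL hc, spearmanFootrule_lowerSemilinear h]
    linarith
  · filter_upwards [hδ] with u hu hum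
    rw [uIoc_of_le zero_le_one] at hum
    rcases hu hum with hu | ⟨hu, hu'⟩
    · rw [hu, sub_self, zero_mul, zero_div]
    · rw [hu, hu']
      ring

end IsLSLDiagonal

/-! ### The extremal family -/

/-- The diagonals at which Chatterjee's correlation and the footrule of `S_δ` agree. -/
noncomputable def extremalDiagonal (c t : ℝ) : ℝ :=
  if t ≤ 0 then 0 else if t ≤ c then t ^ 2 / c else t

theorem extremalDiagonal_sub_mem {c x y : ℝ} (hxy : x ≤ y) :
    0 ≤ extremalDiagonal c y - extremalDiagonal c x ∧
      extremalDiagonal c y - extremalDiagonal c x ≤ 2 * (y - x) := by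
  -- The parabola lies below its chord `t` and above its tangent at `c`, of slope `2`; the tangent
  -- gives the Lipschitz bound across the kink.
  have hsq {t : ℝ} (ht : 0 < t) (htc : t ≤ c) : t ^ 2 / c ≤ t ∧ 2 * t - c ≤ t ^ 2 / c := by
    have hc := ht.trans_le htc
    rw [div_le_iff₀ hc, le_div_iff₀ hc]
    constructor <;> nlinarith [sq_nonneg (t - c)]
  unfold extremalDiagonal
  split_ifs with hy h₁ h₂ h₁ h₂ h₃ h₂ h₃
  · constructor <;> linarith
  · exact absurd (hxy.trans hy) h₁
  · exact absurd (hxy.trans hy) h₁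
  · have := hsq (not_le.1 hy) h₁
    constructor
    · have : 0 < c := (not_le.1 hy).trans_le h₁
      rw [sub_zero]
      positivity
    · linarith
  · have hc : 0 < c := (not_le.1 hy).trans_le h₁
    have he : y ^ 2 / c - x ^ 2 / c = (y - x) * ((y + x) / c) := by
      field_simp
      ring
    rw [he]
    have hle : (y + x) / c ≤ 2 := by
      rw [div_le_iff₀ hc]
      linarith
    have hge : 0 ≤ (y + x) / c := div_nonneg (by linarith) hc.le
    have hsub := sub_nonneg.2 hxy
    exact ⟨mul_nonneg hsub hge, by nlinarith⟩
  · exact absurd (hxy.trans h₁) h₃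
  · constructor <;> linarith
  · have := hsq (not_le.1 h₂) h₃
    constructor <;> linarith
  · constructor <;> linarith

theorem lipschitzWith_extremalDiagonal (c : ℝ) : LipschitzWith 2 (extremalDiagonal c) := by
  refine LipschitzWith.of_dist_le_mul fun x y => ?_
  rw [Real.dist_eq, Real.dist_eq, NNReal.coe_ofNat]
  rcases le_total x y with hxy | hxy
  · have := extremalDiagonal_sub_mem (c := c) hxy
    rw [abs_sub_comm, abs_of_nonneg this.1, abs_sub_comm, abs_of_nonneg (sub_nonneg.2 hxy)]
    exact this.2
  · have := extremalDiagonal_sub_mem (c := c) hxy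
    rw [abs_of_nonneg this.1, abs_of_nonneg (sub_nonneg.2 hxy)]
    exact this.2

theorem extremalDiagonal_div {c t : ℝ} (ht : 0 < t) :
    extremalDiagonal c t / t = if t ≤ c then t / c else 1 := by
  rw [extremalDiagonal, if_neg ht.not_ge]
  split_ifs <;> field_simp

theorem isLSLDiagonal_extremalDiagonal {c : ℝ} (hc : c ≤ 1) :
    IsLSLDiagonal (extremalDiagonal c) where
  nonneg t ht := by
    have := (extremalDiagonal_sub_mem (c := c) ht.1).1
    simpa [extremalDiagonal] using this
  le_self t ht := by
    unfold extremalDiagonal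
    split_ifs with h1 h2
    · exact ht.1
    · rw [div_le_iff₀ ((not_le.1 h1).trans_le h2)]
      nlinarith
    · rfl
  map_one := by
    rw [← div_one (extremalDiagonal c 1), extremalDiagonal_div one_pos]
    split_ifs with h
    · rw [le_antisymm hc h, div_one]
    · rfl
  monotoneOn x _ y _ hxy := sub_nonneg.1 (extremalDiagonal_sub_mem hxy).1
  lipschitzOnWith := (lipschitzWith_extremalDiagonal c).lipschitzOnWith
  monotoneOn_div x hx y hy hxy := by
    simp only [extremalDiagonal_div hx.1, extremalDiagonal_div hy.1]
    split_ifs with hxc hyc hyc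
    · have := hx.1.trans_le hxc
      gcongr
    · exact div_le_one_of_le₀ hxc (hx.1.le.trans hxc)
    · exact absurd (hxy.trans hyc) hxc
    · rfl
  antitoneOn_div_sq x hx y hy hxy := by
    have hsq (t : ℝ) : extremalDiagonal c t / t ^ 2 = extremalDiagonal c t / t / t := by
      rw [div_div, sq]
    simp only [hsq, extremalDiagonal_div hx.1, extremalDiagonal_div hy.1]
    have hx0 := hx.1
    have hy0 := hy.1
    split_ifs with hyc hxc hxc
    · exact le_of_eq (by field_simp)
    · exact absurd (hxy.trans hyc) hxc
    · have hc0 := hx0.trans_le hxc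
      rw [div_div, mul_comm, ← div_div, div_self hx0.ne']
      exact one_div_le_one_div_of_le hc0 (not_le.1 hyc).le
    · exact one_div_le_one_div_of_le hx0 hxy

/-- Below `c` the quotient is the linear function `u / c`, above `c` it is constantly `1`; the kink
at `c` and the endpoint `1` are null. -/
theorem ae_lslSlope_extremalDiagonal {c : ℝ} (hc : c ∈ Icc (0 : ℝ) 1) :
    ∀ᵐ u : ℝ, u ∈ Ioc (0 : ℝ) 1 →
      u * lslSlope (extremalDiagonal c) u = extremalDiagonal c u / u ∨
        extremalDiagonal c u / u = 1 ∧ lslSlope (extremalDiagonal c) u = 0 := by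
  have h := isLSLDiagonal_extremalDiagonal hc.2
  have hne (x : ℝ) : ∀ᵐ u : ℝ, u ≠ x := by simp [ae_iff]
  filter_upwards [hne 1, hne c] with u hu1 huc hu
  have hu' : u ∈ Ioo (0 : ℝ) 1 := ⟨hu.1, lt_of_le_of_ne hu.2 hu1⟩
  have hu0 := hu.1
  rcases lt_or_gt_of_ne huc with huc | huc
  · left
    have hd : HasDerivAt (extremalDiagonal c) (2 * u / c) u := by
      have := (hasDerivAt_pow 2 u).div_const c
      norm_num at this
      refine this.congr_of_eventuallyEq ?_
      filter_upwards [Ioo_mem_nhds hu.1 huc] with t ht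
      rw [extremalDiagonal, if_neg ht.1.not_ge, if_pos ht.2.le]
    rw [h.lslSlope_eq hu' hd.differentiableAt, hd.deriv, extremalDiagonal_div hu.1,
      if_pos huc.le]
    field_simp
    ring
  · right
    have hd : HasDerivAt (extremalDiagonal c) 1 u := by
      refine (hasDerivAt_id' u).congr_of_eventuallyEq ?_
      filter_upwards [Ioi_mem_nhds huc] with t ht
      rw [extremalDiagonal, if_neg (hc.1.trans_lt ht).not_ge, if_neg (not_le.2 ht)]
    rw [h.lslSlope_eq hu' hd.differentiableAt, hd.deriv, extremalDiagonal_div hu.1,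
      if_neg huc.not_ge]
    simp

theorem spearmanFootrule_extremalDiagonal {c : ℝ} (hc : c ∈ Icc (0 : ℝ) 1) :
    spearmanFootrule (lowerSemilinear (extremalDiagonal c)) = 1 - c ^ 2 := by
  have hcont := (lipschitzWith_extremalDiagonal c).continuous
  have h1 : ∫ t in (0 : ℝ)..c, extremalDiagonal c t = ∫ t in (0 : ℝ)..c, t ^ 2 / c := by
    refine intervalIntegral.integral_congr_ae (.of_forall fun t ht => ?_)
    rw [uIoc_of_le hc.1] at ht
    rw [extremalDiagonal, if_neg ht.1.not_ge, if_pos ht.2]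
  have h2 : ∫ t in c..1, extremalDiagonal c t = ∫ t in c..1, t := by
    refine intervalIntegral.integral_congr_ae (.of_forall fun t ht => ?_)
    rw [uIoc_of_le hc.2] at ht
    rw [extremalDiagonal, if_neg (hc.1.trans_lt ht.1).not_ge, if_neg ht.1.not_ge]
  rw [spearmanFootrule_lowerSemilinear (isLSLDiagonal_extremalDiagonal hc.2),
    ← intervalIntegral.integral_add_adjacent_intervals (hcont.intervalIntegrable 0 c)
      (hcont.intervalIntegrable c 1), h1, h2, intervalIntegral.integral_div, integral_pow,
    integral_id]
  -- The sum is `c ^ 3 / 3 / c + (1 - c ^ 2) / 2`; at `c = 0` the first term is `0` by the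
  -- convention for division by zero.
  rcases eq_or_ne c 0 with rfl | hc0
  · norm_num
  · norm_num
    field_simp
    ring

theorem corollary4p7 :
    -- every `S_δ` is the copula of some pair of random variables
    (∀ δ : ℝ → ℝ, IsLSLDiagonal δ →
      ∃ P : Measure (ℝ × ℝ), IsProbabilityMeasure P ∧
        HasCopula P Prod.fst Prod.snd (lowerSemilinear δ)) ∧
    -- the inequality
    (∀ δ : ℝ → ℝ, IsLSLDiagonal δ →
      ∀ (Ω : Type*) [MeasurableSpace Ω] (P : Measure Ω) [IsProbabilityMeasure P] (X Y : Ω → ℝ),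
        HasCopula P X Y (lowerSemilinear δ) →
          chatterjeeXi P X Y ≤ spearmanFootrule (lowerSemilinear δ)) ∧
    -- sharpness: equality is attained at every level in `[0,1]`
    (∀ s ∈ Icc (0 : ℝ) 1, ∃ δ : ℝ → ℝ, IsLSLDiagonal δ ∧
      spearmanFootrule (lowerSemilinear δ) = s ∧
      ∀ (Ω : Type*) [MeasurableSpace Ω] (P : Measure Ω) [IsProbabilityMeasure P] (X Y : Ω → ℝ),
        HasCopula P X Y (lowerSemilinear δ) → chatterjeeXi P X Y = s) := by
  refine ⟨fun δ hδ => ?_, fun δ hδ Ω _ P _ X Y hc => ?_, fun s hs => ?_⟩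
  · obtain ⟨ε, hL, he, hε⟩ := hδ.exists_lipschitzWith
    have := hε.isProbabilityMeasure_lslMeasure hL
    exact ⟨lslMeasure ε, this, (hε.hasCopula_lslMeasure hL).congr fun u hu v hv =>
      (lowerSemilinear_congr he hu hv).symm⟩
  · obtain ⟨ε, hL, he, hε⟩ := hδ.exists_lipschitzWith
    have hC : ∀ u ∈ Icc (0 : ℝ) 1, ∀ v ∈ Icc (0 : ℝ) 1,
        lowerSemilinear δ u v = lowerSemilinear ε u v :=
      fun u hu v hv => lowerSemilinear_congr he hu hv
    rw [spearmanFootrule_congr hC]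
    exact hε.chatterjeeXi_le_spearmanFootrule hL (hc.congr hC)
  -- The parameter solves `1 - c ^ 2 = s`.
  · have hc : √(1 - s) ∈ Icc (0 : ℝ) 1 :=
      ⟨Real.sqrt_nonneg _, Real.sqrt_le_one.2 (by linarith [hs.1])⟩
    have hδ := isLSLDiagonal_extremalDiagonal hc.2
    have hφ : spearmanFootrule (lowerSemilinear (extremalDiagonal √(1 - s))) = s := by
      rw [spearmanFootrule_extremalDiagonal hc, Real.sq_sqrt (by linarith [hs.2])]
      ring
    refine ⟨_, hδ, hφ, fun Ω _ P _ X Y hcop => ?_⟩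
    rw [hδ.chatterjeeXi_eq_spearmanFootrule (lipschitzWith_extremalDiagonal _) hcop
      (ae_lslSlope_extremalDiagonal hc), hφ]
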